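/- Let $R$ be a commutative noetherian ring with $1$ and $R[[t]][x]=R[[t]][x_1,\dots,x_n]$. An element of $R[[t]][x]$ is $x$-homogeneous if all monomials $x^\alpha$ occurring in it have the same degree; an ideal is $x$-homogeneous if it is generated by $x$-homogeneous elements. A monomial ordering is a total ordering $>$ on the monomials $t^\beta x^\alpha$ ($\beta\in\mathbb N$, $\alpha\in\mathbb N^n$) that is compatible with multiplication; it is $t$-local if $1>t$. For such an ordering and $0\ne f\in R[[t]][x]$, let $\operatorname{lt}_>(f)$ be the term of $f$ (with its coefficient) belonging to the greatest monomial occurring in $f$; put $\operatorname{lt}_>(0)=0$ and $\operatorname{tail}_>(f)=f-\operatorname{lt}_>(f)$. For a subset $H\subseteq R[[t]][x]$ let $\operatorname{lt}_>(H)$ be the ideal of $R[t,x]$ generated by $\operatorname{lt}_>(h)$, $h\in H$. A standard basis of an ideal $I\subseteq R[[t]][x]$ is a finite subset $G\subseteq I$ with $\operatorname{lt}_>(G)=\operatorname{lt}_>(I)$. It is minimal if no proper subset of $\{\operatorname{lt}_>(g)\mid g\in G\}$ generates $\operatorname{lt}_>(I)$. It is initially reduced if it is minimal and, for every $g=\sum_\alpha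 g_\alpha x^\alpha\in G$ with $g_\alpha\in R[[t]]$, no term of $\operatorname{tail}_>(g')$ lies in $\operatorname{lt}_>(G)$, where $g'=\sum_\alpha \operatorname{lt}_>(g_\alpha)\,x^\alpha$. **Proposition.** Every $x$-homogeneous ideal $I$ of $R[[t]][x]$ has, for every $t$-local monomial ordering $>$, an initially reduced standard basis with respect to $>$. -/

import Mathlib

open scoped PowerSeries Polynomial

namespace MixedStandardBasis

/-- The monomials `t^β x^α` in `t, x_1, …, x_n`, given by their exponents `(β, α)`; the product of
monomials is the sum of exponents. -/
abbrev Mon (n : ℕ) : Type := ℕ × (Fin n →₀ ℕ)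

/-- The mixed power series polynomial ring `R⟦t⟧[x_1, …, x_n]`. -/
abbrev MixedRing (R : Type*) [CommRing R] (n : ℕ) : Type _ := MvPolynomial (Fin n) R⟦X⟧

/-- The polynomial ring `R[t, x_1, …, x_n] = R[t][x_1, …, x_n]`. -/
abbrev PolyRing (R : Type*) [CommRing R] (n : ℕ) : Type _ := MvPolynomial (Fin n) R[X]

/-- A monomial ordering: a total ordering on the monomials compatible with multiplication.
`lt a b` means that the monomial `a` is smaller than the monomial `b`. No well-ordering is
required. -/
structure MonomialOrdering (n : ℕ) where
  lt : Mon n → Mon n → Prop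
  irrefl : ∀ a, ¬ lt a a
  trans : ∀ a b c, lt a b → lt b c → lt a c
  total : ∀ a b, lt a b ∨ a = b ∨ lt b a
  mul_compat : ∀ a b c, lt a b → lt (a + c) (b + c)

/-- A `t`-local monomial ordering: `t < 1`. -/
structure TLocalMonomialOrdering (n : ℕ) extends MonomialOrdering n where
  t_lt_one : lt (1, 0) (0, 0)

noncomputable section

variable {R : Type*} [CommRing R] {n : ℕ}

/-- The inclusion `R[t, x] ⊆ R⟦t⟧[x]`. -/
def incl : PolyRing R n →+* MixedRing R n :=
  MvPolynomial.map Polynomial.coeToPowerSeries.ringHom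

/-- The coefficient of `t^β x^α` in `f`, where `m = (β, α)`. -/
def coeffAt (f : MixedRing R n) (m : Mon n) : R :=
  PowerSeries.coeff m.1 (MvPolynomial.coeff m.2 f)

/-- The monomials occurring in `f`. -/
def monomials (f : MixedRing R n) : Set (Mon n) := {m | coeffAt f m ≠ 0}

/-- The term `c · t^β x^α ∈ R[t, x]`, where `m = (β, α)`. -/
def mkTerm (m : Mon n) (c : R) : PolyRing R n :=
  MvPolynomial.monomial m.2 (Polynomial.monomial m.1 c)

/-- The terms `c_{β,α} t^β x^α`, `c_{β,α} ≠ 0`, of `f`. -/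
def terms (f : MixedRing R n) : Set (PolyRing R n) :=
  (fun m => mkTerm m (coeffAt f m)) '' monomials f

/-- `f` is `x`-homogeneous: all `x^α` occurring in `f` have the same degree. -/
def IsXHomogeneous (f : MixedRing R n) : Prop :=
  ∃ d : ℕ, MvPolynomial.IsHomogeneous f d

/-- `I` is `x`-homogeneous: it is generated by `x`-homogeneous elements. -/
def IsXHomogeneousIdeal (I : Ideal (MixedRing R n)) : Prop :=
  ∃ S : Set (MixedRing R n), (∀ f ∈ S, IsXHomogeneous f) ∧ Ideal.span S = I

namespace TLocalMonomialOrdering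

variable (o : TLocalMonomialOrdering n)

/-- `m` is the greatest monomial occurring in `f`. -/
def IsLeadingMonomial (f : MixedRing R n) (m : Mon n) : Prop :=
  m ∈ monomials f ∧ ∀ m' ∈ monomials f, m' ≠ m → o.lt m' m

theorem lt_of_t_exp_lt {a b : ℕ} (α : Fin n →₀ ℕ) (h : a < b) : o.lt (b, α) (a, α) := by
  induction b, h using Nat.le_induction with
  | base => simpa [add_comm] using o.mul_compat _ _ (a, α) o.t_lt_one
  | succ b _ ih =>
    refine o.trans _ _ _ ?_ ih
    simpa [add_comm] using o.mul_compat _ _ (b, α) o.t_lt_one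

theorem isLeadingMonomial_unique {f : MixedRing R n} {m m' : Mon n}
    (h : o.IsLeadingMonomial f m) (h' : o.IsLeadingMonomial f m') : m = m' := by
  by_contra hne
  exact o.irrefl _ (o.trans _ _ _ (h'.2 m h.1 hne) (h.2 m' h'.1 (Ne.symm hne)))

theorem exists_greatest (s : Finset (Mon n)) (hs : s.Nonempty) :
    ∃ m ∈ s, ∀ m' ∈ s, m' ≠ m → o.lt m' m := by
  induction hs using Finset.Nonempty.cons_induction with
  | singleton a => exact ⟨a, by simp, by simp⟩
  | cons a s ha hs ih =>
    obtain ⟨m, hm, hmax⟩ := ih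
    rcases o.total a m with h | h | h
    · refine ⟨m, by simp [hm], fun m' hm' hne => ?_⟩
      rcases Finset.mem_cons.1 hm' with rfl | h'
      · exact h
      · exact hmax m' h' hne
    · exact absurd (h ▸ hm) ha
    · refine ⟨a, by simp, fun m' hm' hne => ?_⟩
      rcases Finset.mem_cons.1 hm' with rfl | h'
      · exact absurd rfl hne
      · by_cases hmm : m' = m
        · exact hmm ▸ h
        · exact o.trans _ _ _ (hmax m' h' hmm) h

/-- Every nonzero element has a greatest monomial, as only finitely many `x^α` occur in it and
`t < 1`. -/
theorem exists_isLeadingMonomial {f : MixedRing R n} (hf : f ≠ 0) :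
    ∃ m, o.IsLeadingMonomial f m := by
  classical
  have key : ∀ α : Fin n →₀ ℕ, MvPolynomial.coeff α f ≠ 0 →
      PowerSeries.coeff (MvPolynomial.coeff α f).order.toNat (MvPolynomial.coeff α f) ≠ 0 :=
    fun α h => PowerSeries.coeff_order h
  obtain ⟨m, hm, hmax⟩ := o.exists_greatest
    (f.support.image fun α => ((MvPolynomial.coeff α f).order.toNat, α))
    ((MvPolynomial.support_nonempty.2 hf).image _)
  obtain ⟨α, hα, rfl⟩ := Finset.mem_image.1 hm
  have hmon : ((MvPolynomial.coeff α f).order.toNat, α) ∈ monomials f :=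
    key α (MvPolynomial.mem_support_iff.1 hα)
  refine ⟨_, hmon, ?_⟩
  rintro ⟨b, γ⟩ hb hne
  have hb' : PowerSeries.coeff b (MvPolynomial.coeff γ f) ≠ 0 := hb
  have hγ : MvPolynomial.coeff γ f ≠ 0 := by
    intro h
    rw [h] at hb'
    simp at hb'
  have hle : (MvPolynomial.coeff γ f).order.toNat ≤ b := by
    have h1 := PowerSeries.order_le b hb'
    exact ENat.toNat_le_of_le_natCast h1
  have hmem : ((MvPolynomial.coeff γ f).order.toNat, γ) ∈
      f.support.image fun α => ((MvPolynomial.coeff α f).order.toNat, α) :=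
    Finset.mem_image.2 ⟨γ, MvPolynomial.mem_support_iff.2 hγ, rfl⟩
  rcases hle.lt_or_eq with h | h
  · have h2 := o.lt_of_t_exp_lt γ h
    by_cases he : ((MvPolynomial.coeff γ f).order.toNat, γ) =
        ((MvPolynomial.coeff α f).order.toNat, α)
    · rw [← he]
      exact h2
    · exact o.trans _ _ _ h2 (hmax _ hmem he)
  · subst h
    exact hmax _ hmem hne

open Classical in
/-- The leading monomial of `f` (with a dummy value at `f = 0`, where it is not defined). -/
def leadingMonomial (f : MixedRing R n) : Mon n :=
  if h : f ≠ 0 then (o.exists_isLeadingMonomial h).choose else 0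

/-- The leading coefficient of `f`. -/
def leadingCoeff (f : MixedRing R n) : R := coeffAt f (o.leadingMonomial f)

/-- The leading term of `f`, an element of `R[t, x]`; it is `0` for `f = 0`. -/
def leadingTerm (f : MixedRing R n) : PolyRing R n :=
  mkTerm (o.leadingMonomial f) (o.leadingCoeff f)

/-- The tail of `f`, that is, `f` minus its leading term. -/
def tail (f : MixedRing R n) : MixedRing R n := f - incl (o.leadingTerm f)

/-- The ideal of `R[t, x]` generated by the leading terms of all elements of `H`. For an ideal
`H = I` this is the leading ideal of `I`. -/
def leadingIdeal (H : Set (MixedRing R n)) : Ideal (PolyRing R n) :=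
  Ideal.span (o.leadingTerm '' H)

/-- `G` is a standard basis of `I`: a finite subset of `I` whose leading terms generate the
leading ideal of `I`. -/
def IsStandardBasis (G : Set (MixedRing R n)) (I : Ideal (MixedRing R n)) : Prop :=
  G.Finite ∧ G ⊆ (I : Set (MixedRing R n)) ∧ o.leadingIdeal G = o.leadingIdeal (I : Set _)

/-- Minimality of a standard basis `G` of `I`: no proper subset of the set of leading terms of `G`
generates the leading ideal of `I`. -/
def IsMinimal (G : Set (MixedRing R n)) (I : Ideal (MixedRing R n)) : Prop :=
  ∀ S : Set (PolyRing R n), S ⊂ o.leadingTerm '' G → Ideal.span S ≠ o.leadingIdeal (I : Set _)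

/-- `G` is reduced with respect to `H`: no term of the tail of an element of `G` lies in the ideal
generated by the leading terms of `H`. -/
def IsReducedWrt (G H : Set (MixedRing R n)) : Prop :=
  ∀ g ∈ G, ∀ s ∈ terms (o.tail g), s ∉ o.leadingIdeal H

/-- For `g = ∑ g_α x^α` with `g_α ∈ R⟦t⟧`, the element `g' = ∑ lt(g_α) x^α`. -/
def initialPart (g : MixedRing R n) : MixedRing R n :=
  ∑ α ∈ g.support,
    incl (o.leadingTerm (MvPolynomial.C (MvPolynomial.coeff α g))) * MvPolynomial.monomial α 1

/-- `G` is initially reduced with respect to `H`: the set of all `g' = ∑ lt(g_α) x^α` with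
`g = ∑ g_α x^α` in `G` is reduced with respect to `H`. -/
def IsInitiallyReducedWrt (G H : Set (MixedRing R n)) : Prop :=
  o.IsReducedWrt (o.initialPart '' G) H

/-- `G` is an initially reduced standard basis of `I`: a minimal standard basis that is initially
reduced with respect to itself. -/
def IsInitiallyReducedStandardBasis (G : Set (MixedRing R n)) (I : Ideal (MixedRing R n)) :
    Prop :=
  o.IsStandardBasis G I ∧ o.IsMinimal G I ∧ o.IsInitiallyReducedWrt G G

end TLocalMonomialOrdering

end

end MixedStandardBasis

/-! Every term of an element of the leading ideal of `I` is zero or the leading term of some element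
of `I` (`exists_of_mem_leadingIdeal`). Since `I` contains the `x`-homogeneous components of its
elements, leading terms of homogeneous elements suffice to generate the leading ideal, and as `R[t,
x]` is noetherian, a finite minimal set of them does.

It remains to reduce the tail of a homogeneous `g ∈ I` of degree `d` without touching its leading
term. This happens inside the part of degree `d`, a free `R⟦t⟧`-module of finite rank. There the
reversed ordering is a well-ordering, so coefficients can be replaced from the greatest monomial
downwards by fixed representatives modulo the leading coefficients of elements of `I`. The recursion
is transfinite, since infinitely many monomials may lie above a given one; limits stay in the coset
because submodules are `t`-adically closed by Krull's theorem (`exists_eqOn_of_forall`,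
`exists_normalForm`).

The result is stronger than needed: no term of the whole tail of the new `g` lies in the leading
ideal, and the terms of `g'` are among those of `g`. -/

namespace MixedStandardBasis

/-! ### Local orderings on free modules of finite rank -/

/-- A total ordering on the monomials `t^b e_i` of the free module `R⟦t⟧^ι` such that
multiplication by `t` makes monomials smaller. -/
structure LocalModuleOrdering (ι : Type*) where
  lt : ℕ × ι → ℕ × ι → Prop
  irrefl : ∀ a, ¬ lt a a
  trans : ∀ a b c, lt a b → lt b c → lt a c
  total : ∀ a b, lt a b ∨ a = b ∨ lt b a
  lt_of_exp_lt : ∀ (i : ι) (a b : ℕ), a < b → lt (b, i) (a, i)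

namespace LocalModuleOrdering

variable {ι : Type*} (o : LocalModuleOrdering ι)

/-- Dickson's lemma: an infinite strictly ascending sequence would contain some `t^b e_i` and later
some `t^b' e_i` with `b ≤ b'`, which is not greater. -/
theorem wellFounded_gt [Finite ι] : WellFounded fun a b => o.lt b a := by
  have hq : WellQuasiOrdered fun a b : ℕ × ι => a.1 ≤ b.1 ∧ a.2 = b.2 :=
    (wellQuasiOrdered_le (α := ℕ)).prod (Finite.wellQuasiOrdered (· = ·))
  rw [wellFounded_iff_isEmpty_descending_chain]
  refine ⟨fun ⟨f, hf⟩ => ?_⟩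
  have hmono : ∀ i j, i < j → o.lt (f i) (f j) := fun i j hij => by
    induction j, hij using Nat.le_induction with
    | base => exact hf i
    | succ j _ ih => exact o.trans _ _ _ ih (hf j)
  obtain ⟨i, j, hij, h1, h2⟩ := hq f
  have h := hmono i j hij
  have hi : f i = ((f i).1, (f i).2) := rfl
  have hj : f j = ((f j).1, (f i).2) := by rw [h2]
  rcases h1.lt_or_eq with h3 | h3
  · exact o.irrefl _ (o.trans _ _ _ h (by rw [hi, hj]; exact o.lt_of_exp_lt _ _ _ h3))
  · rw [hi, hj, h3] at h
    exact o.irrefl _ h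

/-- Every nonempty set of monomials has a greatest element. -/
theorem exists_greatest [Finite ι] {s : Set (ℕ × ι)} (hs : s.Nonempty) :
    ∃ m ∈ s, ∀ m' ∈ s, m' = m ∨ o.lt m' m := by
  obtain ⟨m, hm, hmax⟩ := o.wellFounded_gt.has_min s hs
  refine ⟨m, hm, fun m' hm' => ?_⟩
  rcases o.total m' m with h | h | h
  · exact Or.inr h
  · exact Or.inl h
  · exact absurd h (hmax m' hm')

end LocalModuleOrdering

/-! ### Normal forms modulo submodules of `R⟦t⟧^ι` -/

section Module

variable {R : Type*} [CommRing R] {ι : Type*}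

/-- The coefficient of `t^b e_i` in `v ∈ R⟦t⟧^ι`, where `m = (b, i)`. -/
noncomputable def vecCoeff (v : ι → R⟦X⟧) (m : ℕ × ι) : R := PowerSeries.coeff m.1 (v m.2)

@[simp] theorem vecCoeff_add (v w : ι → R⟦X⟧) (m : ℕ × ι) :
    vecCoeff (v + w) m = vecCoeff v m + vecCoeff w m := by simp [vecCoeff]

@[simp] theorem vecCoeff_sub (v w : ι → R⟦X⟧) (m : ℕ × ι) :
    vecCoeff (v - w) m = vecCoeff v m - vecCoeff w m := by simp [vecCoeff]

@[simp] theorem vecCoeff_zero (m : ℕ × ι) : vecCoeff (0 : ι → R⟦X⟧) m = 0 := by simp [vecCoeff]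

theorem vecCoeff_C_smul (c : R) (v : ι → R⟦X⟧) (m : ℕ × ι) :
    vecCoeff ((PowerSeries.C c : R⟦X⟧) • v) m = c * vecCoeff v m := by simp [vecCoeff]

/-- **Krull's intersection theorem** for submodules of `R⟦t⟧^ι`: they are `t`-adically closed. -/
theorem mem_of_forall_X_pow [IsNoetherianRing R] [Finite ι] (N : Submodule R⟦X⟧ (ι → R⟦X⟧))
    (v : ι → R⟦X⟧) (h : ∀ k : ℕ, ∃ w ∈ N, ∃ u : ι → R⟦X⟧, v = w + (PowerSeries.X ^ k : R⟦X⟧) • u) :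
    v ∈ N := by
  -- `1 + ty` has constant coefficient `1`, hence is a unit; so Krull's theorem applies to the
  -- finitely generated module `R⟦t⟧^ι ⧸ N`.
  have hJ : Ideal.span {(PowerSeries.X : R⟦X⟧)} ≤ Ideal.jacobson ⊥ := by
    rw [Ideal.span_singleton_le_iff_mem, Ideal.mem_jacobson_bot]
    intro y
    rw [PowerSeries.isUnit_iff_constantCoeff]
    simp
  rw [← Submodule.Quotient.mk_eq_zero, ← Submodule.mem_bot R⟦X⟧,
    ← Ideal.iInf_pow_smul_eq_bot_of_le_jacobson (M := (ι → R⟦X⟧) ⧸ N) _ hJ, Submodule.mem_iInf]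
  intro k
  obtain ⟨w, hw, u, rfl⟩ := h k
  rw [Submodule.Quotient.mk_add, (Submodule.Quotient.mk_eq_zero N).2 hw, zero_add,
    Submodule.Quotient.mk_smul]
  exact Submodule.smul_mem_smul (Ideal.pow_mem_pow (Ideal.mem_span_singleton_self _) _)
    Submodule.mem_top

/-- A set-theoretic section of `R → R ⧸ L`, which represents the class of `0` by `0`. -/
theorem exists_representatives (L : Ideal R) :
    ∃ ρ : R → R, (∀ c, c - ρ c ∈ L) ∧ (∀ c d, c - d ∈ L → ρ c = ρ d) ∧ ρ 0 = 0 := by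
  classical
  refine ⟨fun c => if c ∈ L then 0 else (Ideal.Quotient.mk L c).out, fun c => ?_,
    fun c d h => ?_, by simp⟩
  · dsimp only
    split_ifs with hc
    · simpa using hc
    · rw [← Ideal.Quotient.eq]
      exact (Quotient.out_eq' (Ideal.Quotient.mk L c)).symm
  · have hcd : c ∈ L ↔ d ∈ L :=
      ⟨fun hc => by simpa using L.sub_mem hc h, fun hd => by simpa using L.add_mem h hd⟩
    simp only [hcd, Ideal.Quotient.eq.2 h]

namespace LocalModuleOrdering

variable (o : LocalModuleOrdering ι) (N : Submodule R⟦X⟧ (ι → R⟦X⟧))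

/-- The coefficients at `m` of the elements of `N` that involve no monomial greater than `m`. -/
def coeffIdeal (m : ℕ × ι) : Ideal R where
  carrier := {c | ∃ h ∈ N, vecCoeff h m = c ∧ ∀ m', o.lt m m' → vecCoeff h m' = 0}
  zero_mem' := ⟨0, N.zero_mem, by simp, by simp⟩
  add_mem' := by
    rintro _ _ ⟨h, hN, rfl, h0⟩ ⟨k, kN, rfl, k0⟩
    exact ⟨h + k, N.add_mem hN kN, by simp, fun m' hm' => by simp [h0 m' hm', k0 m' hm']⟩
  smul_mem' := by
    rintro c _ ⟨h, hN, rfl, h0⟩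
    exact ⟨(PowerSeries.C c : R⟦X⟧) • h, N.smul_mem _ hN, vecCoeff_C_smul _ _ _,
      fun m' hm' => by rw [vecCoeff_C_smul, h0 m' hm', mul_zero]⟩

/-- The elements of `R⟦t⟧^ι` that involve no monomial of the upper set `U`. -/
def supportedOff (R : Type*) [CommRing R] (U : Set (ℕ × ι))
    (hU : ∀ a b, a ∈ U → o.lt a b → b ∈ U) :
    Submodule R⟦X⟧ (ι → R⟦X⟧) where
  carrier := {v | ∀ m ∈ U, vecCoeff v m = 0}
  zero_mem' := by simp
  add_mem' := fun hv hw m hm => by rw [vecCoeff_add, hv m hm, hw m hm, add_zero]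
  -- The coefficient of `p • v` at `t^b e_i` involves `v` only at `t^b' e_i` with `b' ≤ b`; these
  -- are at least as great, so they lie in `U`.
  smul_mem' := fun p v hv m hm => by
    rw [vecCoeff, Pi.smul_apply, smul_eq_mul, PowerSeries.coeff_mul]
    refine Finset.sum_eq_zero fun x hx => ?_
    have hle : x.2 ≤ m.1 := by
      have := Finset.HasAntidiagonal.mem_antidiagonal.1 hx
      omega
    have hmem : (x.2, m.2) ∈ U := by
      rcases hle.lt_or_eq with h | h
      · exact hU m _ hm (o.lt_of_exp_lt _ _ _ h)
      · rwa [h]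
    exact mul_eq_zero_of_right _ (hv _ hmem)

variable [IsNoetherianRing R] [Finite ι]

/-- Coefficients prescribed on an upper set `U` are attained in the coset `f + N` as soon as for
every `m ∈ U` they are attained at all monomials that are at least `m`. -/
theorem exists_eqOn_of_forall (U : Set (ℕ × ι)) (hU : ∀ a b, a ∈ U → o.lt a b → b ∈ U)
    (f : ι → R⟦X⟧) (c : ℕ × ι → R)
    (h : ∀ m ∈ U, ∃ r, r - f ∈ N ∧ ∀ m', m' = m ∨ o.lt m m' → vecCoeff r m' = c m') :
    ∃ r, r - f ∈ N ∧ ∀ m ∈ U, vecCoeff r m = c m := by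
  classical
  set v : ι → R⟦X⟧ := fun i => PowerSeries.mk fun b => c (b, i) with hv
  have hvc : ∀ m, vecCoeff v m = c m := fun m => by simp [hv, vecCoeff]
  -- By closedness it is enough to work modulo `t^k`, where only finitely many monomials of `U` are
  -- relevant. The hypothesis at the least of them handles all of them at once.
  have key : v - f ∈ N ⊔ o.supportedOff R U hU := by
    refine mem_of_forall_X_pow _ _ fun k => ?_
    have hr : ∃ r, r - f ∈ N ∧ ∀ m ∈ U, m.1 < k → vecCoeff r m = c m := by
      by_cases hne : (U ∩ {m | m.1 < k}).Nonempty
      · have hfin : (U ∩ {m | m.1 < k}).Finite := by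
          refine ((Set.finite_Iio k).prod (Set.finite_univ (α := ι))).subset fun m hm => ?_
          exact ⟨hm.2, Set.mem_univ _⟩
        have hmin : ∃ m ∈ U ∩ {m | m.1 < k}, ∀ m' ∈ U ∩ {m | m.1 < k}, ¬ o.lt m' m := by
          have : IsStrictOrder _ o.lt := { irrefl := o.irrefl, trans := o.trans }
          obtain ⟨a, ha⟩ := hne
          obtain ⟨m, -, hm⟩ := WellFounded.has_min (hfin.wellFoundedOn (r := o.lt)) Set.univ
            ⟨⟨a, ha⟩, trivial⟩
          exact ⟨m, m.2, fun m' hm' => hm ⟨m', hm'⟩ trivial⟩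
        obtain ⟨m, hm, hmmin⟩ := hmin
        obtain ⟨r, hrN, hrc⟩ := h m hm.1
        refine ⟨r, hrN, fun m' hm' hk => hrc m' ?_⟩
        rcases o.total m' m with h1 | h1 | h1
        · exact absurd h1 (hmmin m' ⟨hm', hk⟩)
        · exact Or.inl h1
        · exact Or.inr h1
      · exact ⟨f, by simp, fun m hm hk => absurd ⟨m, hm, hk⟩ hne⟩
    obtain ⟨r, hrN, hrc⟩ := hr
    set w : ι → R⟦X⟧ := fun i => PowerSeries.mk fun b =>
      if (b, i) ∈ U then 0 else vecCoeff (v - r) (b, i) with hw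
    have hwc : ∀ m, vecCoeff w m = if m ∈ U then 0 else vecCoeff (v - r) m := fun m => by
      simp [hw, vecCoeff]
    have hdvd : ∀ i, (PowerSeries.X ^ k : R⟦X⟧) ∣ (v - r - w) i := fun i => by
      rw [PowerSeries.X_pow_dvd_iff]
      intro b hb
      change vecCoeff (v - r - w) (b, i) = 0
      rw [vecCoeff_sub, hwc]
      split_ifs with hbU
      · rw [vecCoeff_sub, hvc, hrc _ hbU hb]
        simp
      · simp
    choose u hu using hdvd
    refine ⟨(r - f) + w, Submodule.add_mem_sup hrN fun m hm => by rw [hwc, if_pos hm], u, ?_⟩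
    have : v - r - w = (PowerSeries.X ^ k : R⟦X⟧) • u := funext fun i => by simp [hu i]
    rw [← this]
    abel
  obtain ⟨a, ha, w, hw, hs⟩ := Submodule.mem_sup.1 key
  refine ⟨f + a, by simpa using ha, fun m hm => ?_⟩
  have : f + a = v - w := by rw [eq_sub_iff_add_eq, add_assoc, hs]; abel
  rw [this, vecCoeff_sub, hvc, hw m hm, sub_zero]

/-- Every coset of `N` contains an element none of whose terms is the leading term of an element
of `N`. -/
theorem exists_normalForm (f : ι → R⟦X⟧) :
    ∃ r, r - f ∈ N ∧ ∀ m, vecCoeff r m ∈ o.coeffIdeal N m → vecCoeff r m = 0 := by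
  classical
  choose ρ hρ hρc hρ0 using fun m => exists_representatives (o.coeffIdeal N m)
  have hρρ : ∀ m c, ρ m (ρ m c) = ρ m c := fun m c => (hρc m _ _ (hρ m c)).symm
  -- `P r m`: the element `r` of the coset is in normal form at `m` and above.
  set P : (ι → R⟦X⟧) → ℕ × ι → Prop := fun r m =>
    r - f ∈ N ∧ ∀ m', m' = m ∨ o.lt m m' → ρ m' (vecCoeff r m') = vecCoeff r m' with hP
  have huniq : ∀ r s m, P r m → P s m → ∀ m', m' = m ∨ o.lt m m' →
      vecCoeff r m' = vecCoeff s m' := by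
    -- At the greatest monomial where `r` and `s` differ, the difference of their coefficients lies
    -- in `coeffIdeal`, so the chosen representatives agree after all.
    rintro r s m ⟨hrN, hr⟩ ⟨hsN, hs⟩
    by_contra! hne
    obtain ⟨q, ⟨hq, hqne⟩, hqmax⟩ := o.exists_greatest
      (s := {q | (q = m ∨ o.lt m q) ∧ vecCoeff r q ≠ vecCoeff s q}) hne
    refine hqne ?_
    rw [← hr q hq, ← hs q hq]
    refine hρc q _ _ ⟨r - s, by simpa using N.sub_mem hrN hsN, by simp, fun m' hm' => ?_⟩
    rw [vecCoeff_sub, sub_eq_zero]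
    by_contra hne'
    have hge : m' = m ∨ o.lt m m' := by
      rcases hq with rfl | hq
      · exact Or.inr hm'
      · exact Or.inr (o.trans _ _ _ hq hm')
    rcases hqmax m' ⟨hge, hne'⟩ with h | h
    · exact o.irrefl _ (h ▸ hm')
    · exact o.irrefl _ (o.trans _ _ _ h hm')
  -- By uniqueness, the partial normal forms glue to one family of coefficients.
  set c : ℕ × ι → R := fun m => if h : ∃ r, P r m then vecCoeff h.choose m else 0 with hc
  have hPc : ∀ r m, P r m → ∀ m', m' = m ∨ o.lt m m' → vecCoeff r m' = c m' := by
    intro r m hr m' hm'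
    have hr' : P r m' := ⟨hr.1, fun q hq => hr.2 q (by
      rcases hq with rfl | hq
      · exact hm'
      · rcases hm' with rfl | hm'
        · exact Or.inr hq
        · exact Or.inr (o.trans _ _ _ hm' hq))⟩
    have hex : ∃ r, P r m' := ⟨r, hr'⟩
    simp only [hc, dif_pos hex]
    exact huniq _ _ _ hr' hex.choose_spec m' (Or.inl rfl)
  have hall : ∀ m, ∃ r, P r m := fun m => by
    induction m using o.wellFounded_gt.induction with
    | _ m ih =>
      -- This covers the limit case: one `r` is correct at all monomials above `m`. Subtracting a
      -- suitable `h ∈ N` without monomials above `m` then corrects the coefficient at `m`.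
      obtain ⟨r, hrN, hr⟩ := o.exists_eqOn_of_forall N {q | o.lt m q}
        (fun a b ha hab => o.trans _ _ _ ha hab) f c fun q hq => by
          obtain ⟨r, hr⟩ := ih q hq
          exact ⟨r, hr.1, hPc r q hr⟩
      obtain ⟨h, hhN, hhm, hh0⟩ := hρ m (vecCoeff r m)
      refine ⟨r - h, by rw [sub_right_comm]; exact N.sub_mem hrN hhN, ?_⟩
      rintro m' (rfl | hm')
      · rw [vecCoeff_sub, hhm, sub_sub_cancel, hρρ]
      · obtain ⟨s, hs⟩ := ih m' hm'
        rw [vecCoeff_sub, hh0 m' hm', sub_zero, hr m' hm', ← hPc s m' hs m' (Or.inl rfl)]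
        exact hs.2 m' (Or.inl rfl)
  obtain ⟨r, hrN, hr⟩ := o.exists_eqOn_of_forall N Set.univ (fun _ _ _ _ => trivial) f c
    fun m _ => by
      obtain ⟨r, hr⟩ := hall m
      exact ⟨r, hr.1, hPc r m hr⟩
  refine ⟨r, hrN, fun m hm => ?_⟩
  obtain ⟨s, hs⟩ := hall m
  have hrs : vecCoeff r m = vecCoeff s m := by
    rw [hr m trivial, hPc s m hs m (Or.inl rfl)]
  rw [hrs] at hm ⊢
  rw [← hs.2 m (Or.inl rfl), hρc m _ 0 (by simpa using hm), hρ0]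

/-- The normal form involves no greater monomials than the given element. -/
theorem exists_normalForm_of_lt (f : ι → R⟦X⟧) (m₀ : ℕ × ι)
    (hf : ∀ m, vecCoeff f m ≠ 0 → o.lt m m₀) :
    ∃ r, r - f ∈ N ∧ (∀ m, vecCoeff r m ≠ 0 → o.lt m m₀) ∧
      ∀ m, vecCoeff r m ≠ 0 → vecCoeff r m ∉ o.coeffIdeal N m := by
  obtain ⟨r, hrN, hr⟩ := o.exists_normalForm N f
  refine ⟨r, hrN, ?_, fun m hm hmem => hm (hr m hmem)⟩
  by_contra! hne
  -- Here and above `f` vanishes, so `r - f ∈ N` exhibits the coefficient of `r` at `q` as an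
  -- element of `coeffIdeal`, contradicting the normal form.
  obtain ⟨q, ⟨hq, hql⟩, hqmax⟩ := o.exists_greatest
    (s := {q | vecCoeff r q ≠ 0 ∧ ¬ o.lt q m₀}) hne
  have hfq : ∀ m', m' = q ∨ o.lt q m' → vecCoeff f m' = 0 := by
    intro m' hm'
    by_contra h0
    rcases hm' with rfl | hm'
    · exact hql (hf _ h0)
    · exact hql (o.trans _ _ _ hm' (hf _ h0))
  refine hq (hr q ⟨r - f, hrN, by rw [vecCoeff_sub, hfq q (Or.inl rfl), sub_zero],
    fun m' hm' => ?_⟩)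
  rw [vecCoeff_sub, hfq m' (Or.inr hm'), sub_zero]
  by_contra h0
  rcases hqmax m' ⟨h0, fun h => hql (o.trans _ _ _ hm' h)⟩ with h | h
  · exact o.irrefl _ (h ▸ hm')
  · exact o.irrefl _ (o.trans _ _ _ h hm')

end LocalModuleOrdering

end Module

end MixedStandardBasis

namespace MixedStandardBasis

/-! ### Coefficients and homogeneous components -/

section Coefficients

variable {R : Type*} [CommRing R] {n : ℕ}

@[simp] theorem coeffAt_zero (m : Mon n) : coeffAt (0 : MixedRing R n) m = 0 := by simp [coeffAt]

@[simp] theorem coeffAt_add (f g : MixedRing R n) (m : Mon n) :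
    coeffAt (f + g) m = coeffAt f m + coeffAt g m := by simp [coeffAt]

@[simp] theorem coeffAt_sub (f g : MixedRing R n) (m : Mon n) :
    coeffAt (f - g) m = coeffAt f m - coeffAt g m := by simp [coeffAt]

theorem coeffAt_ext {f g : MixedRing R n} (h : ∀ m, coeffAt f m = coeffAt g m) : f = g := by
  ext α b
  exact h (b, α)

theorem coeffAt_homogeneousComponent (d : ℕ) (f : MixedRing R n) (m : Mon n) :
    coeffAt (MvPolynomial.homogeneousComponent d f) m =
      if m.2.degree = d then coeffAt f m else 0 := by
  rw [coeffAt, MvPolynomial.coeff_homogeneousComponent]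
  split_ifs <;> simp [coeffAt]

theorem coeffAt_eq_zero_of_isHomogeneous {f : MixedRing R n} {d : ℕ}
    (hf : MvPolynomial.IsHomogeneous f d) {m : Mon n} (hm : m.2.degree ≠ d) :
    coeffAt f m = 0 := by
  rw [coeffAt, hf.coeff_eq_zero hm, map_zero]

theorem incl_mkTerm (m : Mon n) (c : R) :
    incl (mkTerm m c) = MvPolynomial.monomial m.2 (PowerSeries.monomial m.1 c) := by
  simp [incl, mkTerm, MvPolynomial.map_monomial]

theorem coeffAt_monomial_mul (k : Mon n) (c : R) (f : MixedRing R n) (m : Mon n) :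
    coeffAt (MvPolynomial.monomial k.2 (PowerSeries.monomial k.1 c) * f) m =
      if k ≤ m then c * coeffAt f (m - k) else 0 := by
  rw [coeffAt, MvPolynomial.coeff_monomial_mul']
  by_cases h2 : k.2 ≤ m.2
  · rw [if_pos h2, ← Polynomial.coe_monomial, ← Polynomial.C_mul_X_pow_eq_monomial,
      Polynomial.coe_mul, Polynomial.coe_pow, Polynomial.coe_C, Polynomial.coe_X, mul_assoc,
      PowerSeries.coeff_C_mul, PowerSeries.coeff_X_pow_mul']
    simp [Prod.le_def, h2, coeffAt]
  · rw [if_neg h2, if_neg fun h => h2 h.2, map_zero]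

theorem coeffAt_incl_mkTerm (k : Mon n) (c : R) (m : Mon n) :
    coeffAt (incl (mkTerm k c)) m = if m = k then c else 0 := by
  classical
  rw [incl_mkTerm, coeffAt, MvPolynomial.coeff_monomial]
  by_cases h2 : k.2 = m.2
  · rw [if_pos h2, PowerSeries.coeff_monomial]
    simp [Prod.ext_iff, h2]
  · rw [if_neg h2, if_neg fun h : m = k => h2 (by rw [h]), map_zero]

attribute [local instance] MvPolynomial.gradedAlgebra in
theorem IsXHomogeneousIdeal.homogeneousComponent_mem {I : Ideal (MixedRing R n)}
    (hI : IsXHomogeneousIdeal I) {f : MixedRing R n} (hf : f ∈ I) (d : ℕ) :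
    MvPolynomial.homogeneousComponent d f ∈ I := by
  obtain ⟨S, hS, rfl⟩ := hI
  exact MvPolynomial.homogeneousComponent_mem_of_mem
    (Ideal.homogeneous_span (MvPolynomial.homogeneousSubmodule (Fin n) R⟦X⟧) S hS) hf d

end Coefficients

/-! ### Leading terms and the leading ideal -/

namespace TLocalMonomialOrdering

variable {R : Type*} [CommRing R] {n : ℕ} (o : TLocalMonomialOrdering n)

theorem add_lt_add_right_iff {a b c : Mon n} : o.lt (a + c) (b + c) ↔ o.lt a b := by
  refine ⟨fun h => ?_, o.mul_compat _ _ _⟩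
  rcases o.total a b with h' | rfl | h'
  · exact h'
  · exact absurd h (o.irrefl _)
  · exact absurd (o.trans _ _ _ h (o.mul_compat _ _ c h')) (o.irrefl _)

theorem not_lt_of_lt {a b : Mon n} (h : o.lt a b) : ¬ o.lt b a :=
  fun h' => o.irrefl _ (o.trans _ _ _ h h')

theorem isLeadingMonomial_leadingMonomial {f : MixedRing R n} (hf : f ≠ 0) :
    o.IsLeadingMonomial f (o.leadingMonomial f) := by
  rw [leadingMonomial, dif_pos hf]
  exact (o.exists_isLeadingMonomial hf).choose_spec

theorem IsLeadingMonomial.coeffAt_eq_zero {o : TLocalMonomialOrdering n} {f : MixedRing R n}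
    {m m' : Mon n} (h : o.IsLeadingMonomial f m) (hm : o.lt m m') : coeffAt f m' = 0 := by
  by_contra hne
  exact o.not_lt_of_lt hm (h.2 m' hne fun he => o.irrefl m (he ▸ hm))

theorem IsLeadingMonomial.ne_zero {o : TLocalMonomialOrdering n} {f : MixedRing R n}
    {m : Mon n} (h : o.IsLeadingMonomial f m) : f ≠ 0 :=
  fun hf => h.1 (by simp [hf])

theorem IsLeadingMonomial.leadingTerm_eq {o : TLocalMonomialOrdering n} {f : MixedRing R n}
    {m : Mon n} (h : o.IsLeadingMonomial f m) : o.leadingTerm f = mkTerm m (coeffAt f m) := by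
  rw [leadingTerm, leadingCoeff,
    o.isLeadingMonomial_unique (o.isLeadingMonomial_leadingMonomial h.ne_zero) h]

@[simp] theorem leadingTerm_zero : o.leadingTerm (0 : MixedRing R n) = 0 := by
  simp [leadingTerm, leadingCoeff, mkTerm]

/-- Passing to a component only deletes monomials, and the leading one survives; so leading terms
can be realized by homogeneous elements. -/
theorem IsLeadingMonomial.homogeneousComponent {o : TLocalMonomialOrdering n}
    {f : MixedRing R n} {m : Mon n} (h : o.IsLeadingMonomial f m) :
    o.IsLeadingMonomial (MvPolynomial.homogeneousComponent m.2.degree f) m := by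
  refine ⟨?_, fun m' hm' => h.2 m' fun h0 => hm' ?_⟩
  · change coeffAt _ _ ≠ 0
    rw [coeffAt_homogeneousComponent, if_pos rfl]
    exact h.1
  · rw [coeffAt_homogeneousComponent, h0, ite_self]

/-- Every term of an element of the leading ideal of `I` is the leading term of an element of `I`
(or zero). -/
theorem exists_of_mem_leadingIdeal {I : Ideal (MixedRing R n)} {p : PolyRing R n}
    (hp : p ∈ o.leadingIdeal (I : Set (MixedRing R n))) :
    ∀ m, ∃ f ∈ I, coeffAt f m = coeffAt (incl p) m ∧ ∀ m', o.lt m m' → coeffAt f m' = 0 := by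
  classical
  induction hp using Submodule.span_induction with
  | mem x hx =>
    obtain ⟨f, hf, rfl⟩ := hx
    intro m
    by_cases hm : f ≠ 0 ∧ m = o.leadingMonomial f
    · obtain ⟨hf0, rfl⟩ := hm
      have hl := o.isLeadingMonomial_leadingMonomial hf0
      refine ⟨f, hf, ?_, fun m' hm' => hl.coeffAt_eq_zero hm'⟩
      rw [hl.leadingTerm_eq, coeffAt_incl_mkTerm, if_pos rfl]
    · refine ⟨0, I.zero_mem, ?_, by simp⟩
      by_cases hf0 : f = 0
      · simp [hf0]
      · rw [(o.isLeadingMonomial_leadingMonomial hf0).leadingTerm_eq, coeffAt_incl_mkTerm,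
          if_neg fun h => hm ⟨hf0, h⟩, coeffAt_zero]
  | zero => exact fun m => ⟨0, I.zero_mem, by simp, by simp⟩
  | add x y _ _ hx hy =>
    intro m
    obtain ⟨f, hf, h1, h2⟩ := hx m
    obtain ⟨g, hg, h3, h4⟩ := hy m
    exact ⟨f + g, I.add_mem hf hg, by simp [h1, h3], fun m' hm' => by simp [h2 m' hm', h4 m' hm']⟩
  | smul a x _ hx =>
    -- The claim is additive in the multiplier, so only multiplication by a single term remains;
    -- this shifts monomials and preserves their order.
    have hadd : ∀ a b : PolyRing R n,
        (∀ m, ∃ f ∈ I, coeffAt f m = coeffAt (incl (a • x)) m ∧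
          ∀ m', o.lt m m' → coeffAt f m' = 0) →
        (∀ m, ∃ f ∈ I, coeffAt f m = coeffAt (incl (b • x)) m ∧
          ∀ m', o.lt m m' → coeffAt f m' = 0) →
        ∀ m, ∃ f ∈ I, coeffAt f m = coeffAt (incl ((a + b) • x)) m ∧
          ∀ m', o.lt m m' → coeffAt f m' = 0 := by
      intro a b ha hb m
      obtain ⟨f, hf, h1, h2⟩ := ha m
      obtain ⟨g, hg, h3, h4⟩ := hb m
      exact ⟨f + g, I.add_mem hf hg, by simp [add_smul, h1, h3, -smul_eq_mul],
        fun m' hm' => by simp [h2 m' hm', h4 m' hm']⟩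
    induction a using MvPolynomial.induction_on' with
    | monomial α a =>
      induction a using Polynomial.induction_on' with
      | add a b ha hb => rw [map_add]; exact hadd _ _ ha hb
      | monomial β c =>
        intro m
        have hmul : ∀ m', coeffAt (incl ((MvPolynomial.monomial α (Polynomial.monomial β c)) • x))
            m' = if ((β, α) : Mon n) ≤ m' then c * coeffAt (incl x) (m' - (β, α)) else 0 := by
          intro m'
          rw [smul_eq_mul, map_mul, ← coeffAt_monomial_mul, ← incl_mkTerm, mkTerm]
        rw [hmul]
        split_ifs with hm
        · obtain ⟨f, hf, h1, h2⟩ := hx (m - (β, α))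
          refine ⟨_, I.mul_mem_left
            (MvPolynomial.monomial α (PowerSeries.monomial β c)) hf, ?_, fun m' hm' => ?_⟩
          · rw [coeffAt_monomial_mul (β, α), if_pos hm, h1]
          · rw [coeffAt_monomial_mul (β, α)]
            split_ifs with hk
            · rw [h2, mul_zero]
              rwa [← o.add_lt_add_right_iff (c := (β, α)), tsub_add_cancel_of_le hm,
                tsub_add_cancel_of_le hk]
            · rfl
        · exact ⟨0, I.zero_mem, by simp, by simp⟩
    | add a b ha hb => exact hadd _ _ ha hb

/-- The leading ideal of an `x`-homogeneous ideal is generated by the leading terms of its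
`x`-homogeneous elements. -/
theorem leadingIdeal_eq_of_isXHomogeneousIdeal {I : Ideal (MixedRing R n)}
    (hI : IsXHomogeneousIdeal I) :
    o.leadingIdeal (I : Set (MixedRing R n)) =
      o.leadingIdeal {f | f ∈ I ∧ f ≠ 0 ∧ IsXHomogeneous f} := by
  refine le_antisymm (Ideal.span_le.2 ?_) (Ideal.span_mono (Set.image_mono fun f hf => hf.1))
  rintro _ ⟨f, hf, rfl⟩
  by_cases hf0 : f = 0
  · simp [hf0]
  have hl := o.isLeadingMonomial_leadingMonomial hf0
  have hc := hl.homogeneousComponent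
  have : o.leadingTerm f = o.leadingTerm
      (MvPolynomial.homogeneousComponent (o.leadingMonomial f).2.degree f) := by
    rw [hl.leadingTerm_eq, hc.leadingTerm_eq, coeffAt_homogeneousComponent, if_pos rfl]
  rw [this]
  exact Ideal.subset_span ⟨_, ⟨hI.homogeneousComponent_mem hf _, hc.ne_zero, _,
    MvPolynomial.homogeneousComponent_isHomogeneous _ _⟩, rfl⟩

/-- The ordering induced on the monomials of fixed `x`-degree. -/
def restrictDegree (d : ℕ) : LocalModuleOrdering {α : Fin n →₀ ℕ // α.degree = d} where
  lt a b := o.lt (a.1, a.2) (b.1, b.2)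
  irrefl _ := o.irrefl _
  trans _ _ _ := o.trans _ _ _
  total a b := by
    rcases o.total (a.1, a.2) (b.1, b.2) with h | h | h
    · exact Or.inl h
    · obtain ⟨h1, h2⟩ := Prod.mk.inj h
      exact Or.inr (Or.inl (Prod.ext h1 (Subtype.ext h2)))
    · exact Or.inr (Or.inr h)
  lt_of_exp_lt i _ _ h := o.lt_of_t_exp_lt i h

end TLocalMonomialOrdering

/-! ### The part of degree `d` as a free `R⟦t⟧`-module -/

section HomogeneousPart

variable (R : Type*) [CommRing R] {n : ℕ}

instance (d : ℕ) : Finite {α : Fin n →₀ ℕ // α.degree = d} :=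
  (Finsupp.finite_of_degree_eq d).to_subtype

/-- The embedding of the free `R⟦t⟧`-module on the `x^α` of degree `d` as the homogeneous part of
degree `d` of `R⟦t⟧[x]`. -/
noncomputable def ofVec (n d : ℕ) :
    ({α : Fin n →₀ ℕ // α.degree = d} → R⟦X⟧) →ₗ[R⟦X⟧] MixedRing R n :=
  letI := Fintype.ofFinite {α : Fin n →₀ ℕ // α.degree = d}
  ∑ i, MvPolynomial.monomial i.1 ∘ₗ LinearMap.proj i

variable {R}

theorem coeffAt_ofVec {d : ℕ} (v : {α : Fin n →₀ ℕ // α.degree = d} → R⟦X⟧) (m : Mon n) :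
    coeffAt (ofVec R n d v) m =
      if h : m.2.degree = d then vecCoeff v (m.1, ⟨m.2, h⟩) else 0 := by
  classical
  let _ := Fintype.ofFinite {α : Fin n →₀ ℕ // α.degree = d}
  have : MvPolynomial.coeff m.2 (ofVec R n d v) =
      if h : m.2.degree = d then v ⟨m.2, h⟩ else 0 := by
    simp only [ofVec, LinearMap.sum_apply, LinearMap.comp_apply, LinearMap.proj_apply,
      MvPolynomial.coeff_sum, MvPolynomial.coeff_monomial]
    split_ifs with h
    · rw [Finset.sum_eq_single ⟨m.2, h⟩]
      · simp
      · intro i _ hi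
        rw [if_neg fun he => hi (Subtype.ext he)]
      · simp
    · exact Finset.sum_eq_zero fun i _ => if_neg fun he : i.1 = m.2 => h (he ▸ i.2)
  rw [coeffAt, this]
  split_ifs <;> simp [vecCoeff]

theorem ofVec_coeff {f : MixedRing R n} {d : ℕ} (hf : MvPolynomial.IsHomogeneous f d) :
    ofVec R n d (fun i => MvPolynomial.coeff i.1 f) = f := by
  refine coeffAt_ext fun m => ?_
  rw [coeffAt_ofVec]
  split_ifs with h
  · rfl
  · rw [coeffAt_eq_zero_of_isHomogeneous hf h]

end HomogeneousPart

/-! ### Reduction of homogeneous elements and initial parts -/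

namespace TLocalMonomialOrdering

variable {R : Type*} [CommRing R] {n : ℕ} (o : TLocalMonomialOrdering n)

/-- A homogeneous element of an `x`-homogeneous ideal can be replaced by one with the same leading
term, no further term of which lies in the leading ideal. -/
theorem exists_reduced [IsNoetherianRing R] {I : Ideal (MixedRing R n)}
    (hI : IsXHomogeneousIdeal I) {g : MixedRing R n} (hg : g ∈ I) (hg0 : g ≠ 0)
    (hgh : IsXHomogeneous g) :
    ∃ h ∈ I, ∃ m₀, o.IsLeadingMonomial h m₀ ∧ o.leadingTerm h = o.leadingTerm g ∧
      ∀ m, m ≠ m₀ → coeffAt h m ≠ 0 →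
        mkTerm m (coeffAt h m) ∉ o.leadingIdeal (I : Set (MixedRing R n)) := by
  classical
  obtain ⟨d, hd⟩ := hgh
  have hl := o.isLeadingMonomial_leadingMonomial hg0
  set m₀ := o.leadingMonomial g with hm₀
  have hdeg : m₀.2.degree = d := by
    by_contra h
    exact hl.1 (coeffAt_eq_zero_of_isHomogeneous hd h)
  set N := (I.restrictScalars R⟦X⟧).comap (ofVec R n d) with hN
  have hmemN : ∀ v, v ∈ N ↔ ofVec R n d v ∈ I := fun v => Iff.rfl
  have htail : ∀ m, coeffAt (o.tail g) m = if m = m₀ then 0 else coeffAt g m := by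
    intro m
    rw [tail, coeffAt_sub, hl.leadingTerm_eq, coeffAt_incl_mkTerm]
    split_ifs with h
    · rw [h, sub_self]
    · rw [sub_zero]
  -- Only the tail is reduced, and its normal form stays below `m₀`.
  obtain ⟨r, hrN, hrlt, hred⟩ := (o.restrictDegree d).exists_normalForm_of_lt N
    (fun i => MvPolynomial.coeff i.1 (o.tail g)) (m₀.1, ⟨m₀.2, hdeg⟩) (by
      rintro ⟨b, i⟩ hm
      have hm' : coeffAt (o.tail g) (b, i.1) ≠ 0 := hm
      rw [htail] at hm'
      split_ifs at hm' with h
      · exact absurd rfl hm'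
      · exact hl.2 _ hm' h)
  -- This is the leading term of `g` plus the reduced tail `r`, written so that membership in `I` is
  -- evident.
  set h := g + ofVec R n d (r - fun i => MvPolynomial.coeff i.1 (o.tail g)) with hh
  have hhI : h ∈ I := I.add_mem hg hrN
  have hcoeff : ∀ m, coeffAt h m = if m = m₀ then coeffAt g m₀ else
      coeffAt (ofVec R n d r) m := by
    intro m
    rw [hh, coeffAt_add, coeffAt_ofVec, coeffAt_ofVec]
    by_cases hmd : m.2.degree = d
    · rw [dif_pos hmd, dif_pos hmd, vecCoeff_sub]
      have h1 : vecCoeff (fun i : {α : Fin n →₀ ℕ // α.degree = d} =>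
          MvPolynomial.coeff i.1 (o.tail g)) (m.1, ⟨m.2, hmd⟩) = coeffAt (o.tail g) m := rfl
      rw [h1, htail]
      split_ifs with hm
      · rw [hm] at hmd
        simp only [hm]
        have : vecCoeff r (m₀.1, ⟨m₀.2, hmd⟩) = 0 := by
          by_contra h0
          exact (o.restrictDegree d).irrefl _ (hrlt _ h0)
        rw [this]
        simp
      · ring
    · rw [dif_neg hmd, dif_neg hmd, coeffAt_eq_zero_of_isHomogeneous hd hmd,
        if_neg fun hm : m = m₀ => hmd (by rw [hm, hdeg]), add_zero]
  have hne : ∀ m, m ≠ m₀ → coeffAt h m ≠ 0 → ∃ hmd : m.2.degree = d,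
      coeffAt h m = vecCoeff r (m.1, ⟨m.2, hmd⟩) := by
    intro m hm hm0
    rw [hcoeff, if_neg hm, coeffAt_ofVec] at hm0 ⊢
    split_ifs at hm0 ⊢ with hmd
    · exact ⟨hmd, rfl⟩
    · exact absurd rfl hm0
  have hhl : o.IsLeadingMonomial h m₀ := by
    refine ⟨?_, fun m hm hmne => ?_⟩
    · change coeffAt h m₀ ≠ 0
      rw [hcoeff, if_pos rfl]
      exact hl.1
    · obtain ⟨hmd, he⟩ := hne m hmne hm
      have hm' : coeffAt h m ≠ 0 := hm
      rw [he] at hm'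
      exact hrlt _ hm'
  refine ⟨h, hhI, m₀, hhl, ?_, fun m hm hm0 hmem => ?_⟩
  · rw [hhl.leadingTerm_eq, hl.leadingTerm_eq, hcoeff, if_pos rfl]
  -- The component of degree `d` of `k` would put the coefficient of `r` at `m` into `coeffIdeal`.
  · obtain ⟨k, hkI, hkm, hk0⟩ := o.exists_of_mem_leadingIdeal hmem m
    rw [coeffAt_incl_mkTerm, if_pos rfl] at hkm
    obtain ⟨hmd, he⟩ := hne m hm hm0
    rw [he] at hkm hm0
    have hkd := MvPolynomial.homogeneousComponent_isHomogeneous d k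
    have hvec : ∀ q : ℕ × {α : Fin n →₀ ℕ // α.degree = d},
        vecCoeff (fun i => MvPolynomial.coeff i.1 (MvPolynomial.homogeneousComponent d k)) q =
          coeffAt k (q.1, q.2) := by
      intro q
      change coeffAt (MvPolynomial.homogeneousComponent d k) (q.1, q.2.1) = _
      rw [coeffAt_homogeneousComponent, if_pos q.2.2]
    refine hred _ hm0 ⟨fun i => MvPolynomial.coeff i.1 (MvPolynomial.homogeneousComponent d k),
      ?_, ?_, fun q hq => ?_⟩
    · rw [hmemN, ofVec_coeff hkd]
      exact hI.homogeneousComponent_mem hkI d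
    · rw [hvec]
      exact hkm
    · rw [hvec]
      exact hk0 _ hq

open Classical in
/-- The coefficients of `g' = ∑ lt(g_α) x^α`: in every `g_α` only the term of least order is
kept. -/
theorem coeffAt_initialPart (g : MixedRing R n) (m : Mon n) :
    coeffAt (o.initialPart g) m =
      if ∀ b < m.1, coeffAt g (b, m.2) = 0 then coeffAt g m else 0 := by
  have hC : ∀ α ∈ g.support, ∃ b, coeffAt g (b, α) ≠ 0 ∧ (∀ b' < b, coeffAt g (b', α) = 0) ∧
      incl (o.leadingTerm (MvPolynomial.C (MvPolynomial.coeff α g))) *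
        MvPolynomial.monomial α 1 =
      MvPolynomial.monomial α (PowerSeries.monomial b (coeffAt g (b, α))) := by
    intro α hα
    have hα0 := MvPolynomial.mem_support_iff.1 hα
    have hcC : ∀ q : Mon n, coeffAt (MvPolynomial.C (MvPolynomial.coeff α g) : MixedRing R n) q =
        if q.2 = 0 then coeffAt g (q.1, α) else 0 := by
      intro q
      rw [coeffAt, MvPolynomial.coeff_C]
      simp only [eq_comm (a := (0 : Fin n →₀ ℕ))]
      split_ifs <;> simp [coeffAt]
    have hl := o.isLeadingMonomial_leadingMonomial (MvPolynomial.C_ne_zero.2 hα0)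
    generalize o.leadingMonomial (MvPolynomial.C (MvPolynomial.coeff α g) : MixedRing R n) = q
      at hl
    have hq : coeffAt (MvPolynomial.C (MvPolynomial.coeff α g) : MixedRing R n) q ≠ 0 := hl.1
    have hq2 : q.2 = 0 := by
      by_contra h
      rw [hcC, if_neg h] at hq
      exact hq rfl
    have hterm := hl.leadingTerm_eq
    rw [hcC, if_pos hq2] at hq hterm
    refine ⟨q.1, hq, fun b' hb' => ?_, ?_⟩
    -- As `t < 1`, a smaller power of `t` would be a greater monomial than the leading one.
    · have hlt : o.lt q (b', 0) := by
        have := o.lt_of_t_exp_lt 0 hb'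
        rwa [← hq2] at this ⊢
      have := hl.coeffAt_eq_zero hlt
      rwa [hcC, if_pos rfl] at this
    · rw [hterm, incl_mkTerm, MvPolynomial.monomial_mul, hq2, zero_add, mul_one]
  choose! b hb hb' hbe using hC
  rw [initialPart, Finset.sum_congr rfl hbe, coeffAt, MvPolynomial.coeff_sum]
  simp only [MvPolynomial.coeff_monomial]
  rw [Finset.sum_ite_eq']
  by_cases hm : m.2 ∈ g.support
  · rw [if_pos hm, PowerSeries.coeff_monomial]
    split_ifs with h1 h2 h2
    · rw [← h1]
    · rw [h1] at h2
      exact absurd (hb' _ hm) h2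
    · by_contra h0
      rcases lt_trichotomy m.1 (b m.2) with h | h | h
      · exact h0 (hb' _ hm _ h).symm
      · exact h1 h
      · exact hb _ hm (h2 _ h)
    · rfl
  · have : coeffAt g m = 0 := by
      rw [coeffAt, MvPolynomial.notMem_support_iff.1 hm, map_zero]
    rw [if_neg hm, this, map_zero, ite_self]

/-- An element none of whose terms except for the leading one lies in an ideal `J` stays such
when passing to the initial part. -/
theorem notMem_of_mem_terms_tail_initialPart {h : MixedRing R n} {m₀ : Mon n}
    (hl : o.IsLeadingMonomial h m₀) {J : Ideal (PolyRing R n)}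
    (hJ : ∀ m, m ≠ m₀ → coeffAt h m ≠ 0 → mkTerm m (coeffAt h m) ∉ J) :
    ∀ s ∈ terms (o.tail (o.initialPart h)), s ∉ J := by
  -- The leading term survives in the initial part: a smaller power of `t` with the same `x^α` would
  -- be greater.
  have hm₀ : coeffAt (o.initialPart h) m₀ = coeffAt h m₀ := by
    rw [coeffAt_initialPart, if_pos fun b hb => hl.coeffAt_eq_zero (o.lt_of_t_exp_lt m₀.2 hb)]
  have hne : ∀ m, coeffAt (o.initialPart h) m ≠ 0 →
      coeffAt (o.initialPart h) m = coeffAt h m := by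
    intro m hm
    rw [coeffAt_initialPart] at hm ⊢
    split_ifs at hm ⊢
    · rfl
    · exact absurd rfl hm
  have hil : o.IsLeadingMonomial (o.initialPart h) m₀ := by
    refine ⟨?_, fun m hm => hl.2 m ?_⟩
    · change coeffAt _ _ ≠ 0
      rw [hm₀]
      exact hl.1
    · change coeffAt _ _ ≠ 0
      rw [← hne m hm]
      exact hm
  rintro _ ⟨m, hm, rfl⟩
  have hm' : coeffAt (o.tail (o.initialPart h)) m ≠ 0 := hm
  have hc : coeffAt (o.tail (o.initialPart h)) m = coeffAt (o.initialPart h) m -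
      if m = m₀ then coeffAt (o.initialPart h) m₀ else 0 := by
    rw [tail, coeffAt_sub, hil.leadingTerm_eq, coeffAt_incl_mkTerm]
  by_cases hmm : m = m₀
  · rw [hc, if_pos hmm, hmm, sub_self] at hm'
    exact absurd rfl hm'
  · rw [if_neg hmm, sub_zero] at hc
    rw [hc] at hm'
    simp only [hc, hne m hm']
    exact hJ m hmm (hne m hm' ▸ hm')

end TLocalMonomialOrdering

/-! ### Minimal generating sets and the standard basis -/

/-- In a noetherian ring every generating set of an ideal contains a finite one that is minimal. -/
theorem exists_minimal_finset_span_eq {A : Type*} [CommRing A] [IsNoetherianRing A] (S : Set A) :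
    ∃ T : Finset A, (T : Set A) ⊆ S ∧ Ideal.span (T : Set A) = Ideal.span S ∧
      ∀ T' : Set A, T' ⊂ T → Ideal.span T' ≠ Ideal.span S := by
  classical
  obtain ⟨T₀, hT₀, he⟩ := (Submodule.fg_span_iff_fg_span_finset_subset (R := A) S).1
    (IsNoetherian.noetherian (Ideal.span S))
  obtain ⟨T, ⟨hTS, hT⟩, hmin⟩ := wellFounded_lt.has_min
    {T : Finset A | (T : Set A) ⊆ S ∧ Ideal.span (T : Set A) = Ideal.span S} ⟨T₀, hT₀, he.symm⟩
  refine ⟨T, hTS, hT, fun T' hT' hspan => ?_⟩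
  lift T' to Finset A using T.finite_toSet.subset hT'.subset
  exact hmin T' ⟨hT'.subset.trans hTS, hspan⟩ (Finset.coe_ssubset.1 hT')

end MixedStandardBasis

open MixedStandardBasis in
theorem exists_isInitiallyReducedStandardBasis {R : Type*} [CommRing R] [IsNoetherianRing R]
    {n : ℕ} (I : Ideal (MixedRing R n)) (hI : IsXHomogeneousIdeal I)
    (o : TLocalMonomialOrdering n) :
    ∃ G : Set (MixedRing R n), o.IsInitiallyReducedStandardBasis G I := by
  obtain ⟨T, hTS, hT, hmin⟩ := exists_minimal_finset_span_eq
    (o.leadingTerm '' {f | f ∈ I ∧ f ≠ 0 ∧ IsXHomogeneous f})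
  change _ = o.leadingIdeal _ at hT
  change ∀ T', _ → _ ≠ o.leadingIdeal _ at hmin
  rw [← o.leadingIdeal_eq_of_isXHomogeneousIdeal hI] at hT hmin
  have hex : ∀ τ ∈ T, ∃ h ∈ I, ∃ m₀, o.IsLeadingMonomial h m₀ ∧ o.leadingTerm h = τ ∧
      ∀ m, m ≠ m₀ → coeffAt h m ≠ 0 →
        mkTerm m (coeffAt h m) ∉ o.leadingIdeal (I : Set (MixedRing R n)) := by
    intro τ hτ
    obtain ⟨g, ⟨hgI, hg0, hgh⟩, rfl⟩ := hTS hτ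
    exact o.exists_reduced hI hgI hg0 hgh
  choose! g hgI m₀ hgl hgτ hgred using hex
  -- `g` is a section of `leadingTerm` over `T`, so the basis has exactly `T` as leading terms and
  -- inherits its minimality.
  have himage : o.leadingTerm '' (g '' (T : Set (PolyRing R n))) = T := by
    rw [Set.image_image, Set.image_congr hgτ, Set.image_id']
  have hlead : o.leadingIdeal (g '' (T : Set (PolyRing R n))) =
      o.leadingIdeal (I : Set (MixedRing R n)) := by
    rw [TLocalMonomialOrdering.leadingIdeal, himage, hT]
  refine ⟨g '' T, ⟨T.finite_toSet.image g, ?_, hlead⟩, ?_, ?_⟩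
  · rintro _ ⟨τ, hτ, rfl⟩
    exact hgI τ hτ
  · intro S hS
    rw [himage] at hS
    exact hmin S hS
  · rintro _ ⟨_, ⟨τ, hτ, rfl⟩, rfl⟩
    rw [hlead]
    exact o.notMem_of_mem_terms_tail_initialPart (hgl τ hτ) (hgred τ hτ)

theorem proposition3p3 {R : Type*} [CommRing R] [IsNoetherianRing R] {n : ℕ}
    (I : Ideal (MixedStandardBasis.MixedRing R n))
    (hI : MixedStandardBasis.IsXHomogeneousIdeal I)
    (o : MixedStandardBasis.TLocalMonomialOrdering n) :
    ∃ G : Set (MixedStandardBasis.MixedRing R n),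
      o.IsInitiallyReducedStandardBasis G I :=
  exists_isInitiallyReducedStandardBasis I hI o
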